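/- For Borel measures on $\mathbb{R}^d$, write $\mathcal P(\mathbb{R}^d)$ for the probability measures and $\mathcal P_2(\mathbb{R}^d)$ for those with finite second moment. For $\mu_0,\nu\in\mathcal P(\mathbb{R}^d)$, let $T_{\mu_0}^{\nu}$ denote an optimal transport map from $\mu_0$ to $\nu$, i.e. a Borel map with $T_{\mu_0}^{\nu}\#\mu_0=\nu$ that minimizes $\int\|T(x)-x\|^2\,d\mu_0(x)\in[0,\infty]$ among all Borel maps $T$ with $T\#\mu_0=\nu$. (If $\mu_0\in\mathcal P_2(\mathbb{R}^d)$ is absolutely continuous, such a map exists; it is unique $\mu_0$-a.e. if $\nu\in\mathcal P_2(\mathbb{R}^d)$, while for $\nu\notin\mathcal P_2(\mathbb{R}^d)$ every transport map has infinite cost and is not in $L^2(\mu_0)$, and any one of them may be taken.) Proposition. Let $\mu_0\in\mathcal P_2(\mathbb{R}^d)$ be absolutely continuous with respect to Lebesgue measure, let $\mu_1,\dots,\mu_m\in\mathcal P_2(\mathbb{R}^d)$, and let $\lambda\in\Delta^m$, i.e. $\lambda_i\ge 0$ and $\sum_{i=1}^m\lambda_i=1$. Then the optimization problem $$\operatorname*{arg\,min}_{\nu\in\mathcal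 P(\mathbb{R}^d)}\ \sum_{i=1}^m\lambda_i\,\bigl\|T_{\mu_0}^{\nu}-T_{\mu_0}^{\mu_i}\bigr\|_{L^2(\mu_0)}^2,$$ where $\|f\|_{L^2(\mu_0)}^2=\int\|f(x)\|^2\,d\mu_0(x)\in[0,\infty]$ and $0\cdot\infty=0$, has exactly one solution, namely $$\mu_\lambda=\Bigl(\sum_{i=1}^m\lambda_i T_{\mu_0}^{\mu_i}\Bigr)\#\mu_0 ,$$ and $\mu_\lambda\in\mathcal P_2(\mathbb{R}^d)$. -/

import Mathlib

open MeasureTheory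
open scoped ENNReal

noncomputable section

/-- `T` is an optimal transport map from `μ` to `ν` for the squared Euclidean cost: it pushes `μ`
forward to `ν`, and it minimizes `∫ ‖T x - x‖² dμ(x)` (a value in `[0, ∞]`) among all measurable
maps that do. -/
structure IsOptimalTransportMap {d : ℕ} (μ ν : Measure (EuclideanSpace ℝ (Fin d)))
    (T : EuclideanSpace ℝ (Fin d) → EuclideanSpace ℝ (Fin d)) : Prop where
  measurable : Measurable T
  map_eq : μ.map T = ν
  cost_le : ∀ S : EuclideanSpace ℝ (Fin d) → EuclideanSpace ℝ (Fin d),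
    Measurable S → μ.map S = ν →
      ∫⁻ x, ‖T x - x‖ₑ ^ 2 ∂μ ≤ ∫⁻ x, ‖S x - x‖ₑ ^ 2 ∂μ

open Classical in
/-- The optimal transport map from `μ` to `ν`. For `μ` absolutely continuous and `μ`, `ν` with
finite second moment it exists and is unique `μ`-almost everywhere. If `μ` is as before and `ν` is
a probability measure of infinite second moment, every transport map has infinite cost; the value
is then one of these transport maps, and it is not in `L²(μ)`. The default value, the identity, is
taken only when there is no optimal map at all. -/
def otMap {d : ℕ} (μ ν : Measure (EuclideanSpace ℝ (Fin d))) :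
    EuclideanSpace ℝ (Fin d) → EuclideanSpace ℝ (Fin d) :=
  if h : ∃ T, IsOptimalTransportMap μ ν T then h.choose else id

/-- The squared linear optimal transport distance `‖T_{μ₀}^μ - T_{μ₀}^ν‖²` in `L²(μ₀)`, with value
`∞` if the difference of the two maps is not in `L²(μ₀)`. -/
def lotDistSq {d : ℕ} (μ₀ μ ν : Measure (EuclideanSpace ℝ (Fin d))) : ℝ≥0∞ :=
  ∫⁻ x, ‖otMap μ₀ μ x - otMap μ₀ ν x‖ₑ ^ 2 ∂μ₀

/-- The objective `ν ↦ ∑ i, w i * ‖T_{μ₀}^ν - T_{μ₀}^{μ i}‖²` of the variational problem. -/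
def lbcmObjective {d m : ℕ} (μ₀ : Measure (EuclideanSpace ℝ (Fin d)))
    (μ : Fin m → Measure (EuclideanSpace ℝ (Fin d))) (w : Fin m → ℝ)
    (ν : Measure (EuclideanSpace ℝ (Fin d))) : ℝ≥0∞ :=
  ∑ i, ENNReal.ofReal (w i) * lotDistSq μ₀ ν (μ i)

/-- The set of minimizers of the objective among all Borel probability measures. -/
def lbcmArgmin {d m : ℕ} (μ₀ : Measure (EuclideanSpace ℝ (Fin d)))
    (μ : Fin m → Measure (EuclideanSpace ℝ (Fin d))) (w : Fin m → ℝ) :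
    Set (Measure (EuclideanSpace ℝ (Fin d))) :=
  {ν | IsProbabilityMeasure ν ∧ ∀ η : Measure (EuclideanSpace ℝ (Fin d)),
    IsProbabilityMeasure η → lbcmObjective μ₀ μ w ν ≤ lbcmObjective μ₀ μ w η}

end

/-! In the Hilbert space `L²(μ₀)`, the weighted sum of squared distances from a point to the maps `T
i = otMap μ₀ (μ i)` is its squared distance to the mean `b = ∑ i, w i • T i` plus a constant
(`sum_mul_norm_sub_sq`). So the objective at `ν` is `‖T_ν - b‖² + K` with `K` finite, and it remains
to see that `b` itself is an optimal map. By Brenier's theorem each `T i` is a convex gradient;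
nonnegative combinations of convex gradients are convex gradients (`IsConvexGradient.sum_smul`), and
a convex gradient in `L²(μ₀)` is the a.e. unique optimal map onto its image. Hence `ν = b#μ₀`
attains `K`. Conversely, the value `K` forces `T_ν = b` a.e., so `ν = T_ν#μ₀ = b#μ₀`.

Most of the work is Brenier's theorem. Existence: an optimal coupling has cyclically monotone
support, which lies in a subdifferential (Rockafellar), and subgradients are a.e. unique, so the
coupling sits on a graph. Optimality and uniqueness come from the Fenchel–Young inequality and its
equality case. For `ν` of infinite second moment only some transport map is needed. -/

/-! ### Almost everywhere uniqueness of subgradients -/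

section Subgradient

variable {E : Type*} [NormedAddCommGroup E] [InnerProductSpace ℝ E]

/-- `p` is a subgradient at `x` of the restriction of `φ` to `A`. -/
def IsSubgradientOn (φ : E → ℝ) (A : Set E) (x p : E) : Prop :=
  ∀ z ∈ A, φ x + inner ℝ p (z - x) ≤ φ z

/-- `T` is `μ`-almost everywhere a selection of the subdifferential of a function. -/
def IsConvexGradient [MeasurableSpace E] (μ : Measure E) (T : E → E) : Prop :=
  ∃ (φ : E → ℝ) (A : Set E), (∀ᵐ x ∂μ, x ∈ A) ∧ ∀ x ∈ A, IsSubgradientOn φ A x (T x)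

/-- The domain is restricted to points with a finite supremum, because the real `⨆` of an unbounded
family takes the default value 0. -/
theorem convexOn_iSup_affine {ι : Type*} [Nonempty ι] (a : ι → ℝ) (x p : ι → E) :
    ConvexOn ℝ {z | BddAbove (Set.range fun i => a i + inner ℝ (p i) (z - x i))}
      (fun z => ⨆ i, (a i + inner ℝ (p i) (z - x i))) := by
  have key : ∀ z₁ z₂ : E, ∀ s t : ℝ, s + t = 1 → ∀ i,
      a i + inner ℝ (p i) (s • z₁ + t • z₂ - x i) =
        s * (a i + inner ℝ (p i) (z₁ - x i)) + t * (a i + inner ℝ (p i) (z₂ - x i)) := by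
    intro z₁ z₂ s t hst i
    obtain rfl : t = 1 - s := by linarith
    simp only [inner_sub_right, inner_add_right, inner_smul_right]
    ring
  have bound : ∀ z₁ ∈ {z | BddAbove (Set.range fun i => a i + inner ℝ (p i) (z - x i))},
      ∀ z₂ ∈ {z | BddAbove (Set.range fun i => a i + inner ℝ (p i) (z - x i))},
      ∀ s t : ℝ, 0 ≤ s → 0 ≤ t → s + t = 1 → ∀ i,
      a i + inner ℝ (p i) (s • z₁ + t • z₂ - x i) ≤
        s * (⨆ i, (a i + inner ℝ (p i) (z₁ - x i))) +
          t * (⨆ i, (a i + inner ℝ (p i) (z₂ - x i))) := by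
    intro z₁ h₁ z₂ h₂ s t hs ht hst i
    rw [key z₁ z₂ s t hst i]
    gcongr
    · exact le_ciSup h₁ i
    · exact le_ciSup h₂ i
  refine ⟨fun z₁ h₁ z₂ h₂ s t hs ht hst => ?_, fun z₁ h₁ z₂ h₂ s t hs ht hst => ?_⟩
  · refine ⟨s * (⨆ i, (a i + inner ℝ (p i) (z₁ - x i))) +
      t * (⨆ i, (a i + inner ℝ (p i) (z₂ - x i))), ?_⟩
    rintro _ ⟨i, rfl⟩
    exact bound z₁ h₁ z₂ h₂ s t hs ht hst i
  · exact ciSup_le (bound z₁ h₁ z₂ h₂ s t hs ht hst)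

variable [FiniteDimensional ℝ E] [MeasurableSpace E] [BorelSpace E]

/-- The frontier of a convex set is null, and inside a convex function is locally Lipschitz, so
Rademacher's theorem applies. -/
theorem ConvexOn.ae_differentiableAt {D : Set E} {g : E → ℝ} (hg : ConvexOn ℝ D g) :
    ∀ᵐ x : E, x ∈ D → x ∈ interior D ∧ DifferentiableAt ℝ g x := by
  have hnull : volume {x ∈ interior D | ¬ DifferentiableAt ℝ g x} = 0 := by
    refine measure_null_of_locally_null _ fun x hx => ?_
    obtain ⟨K, t, ht, hK⟩ := hg.locallyLipschitzOn_interior hx.1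
    rw [isOpen_interior.nhdsWithin_eq hx.1] at ht
    have hae := (hK.mono interior_subset).ae_differentiableWithinAt_of_mem (μ := volume)
      (s := interior t)
    refine ⟨{y | ¬ (y ∈ interior t → DifferentiableWithinAt ℝ g (interior t) y)}, ?_, hae⟩
    filter_upwards [self_mem_nhdsWithin, mem_nhdsWithin_of_mem_nhds (interior_mem_nhds.2 ht)]
      with y hy hyt
    exact fun h => hy.2 ((h hyt).differentiableAt (isOpen_interior.mem_nhds hyt))
  have hfr : volume (frontier D) = 0 := hg.1.addHaar_frontier volume
  filter_upwards [measure_eq_zero_iff_ae_notMem.1 hnull, measure_eq_zero_iff_ae_notMem.1 hfr]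
    with x h₁ h₂ hx
  have hi : x ∈ interior D := by
    by_contra h
    exact h₂ ⟨subset_closure hx, h⟩
  exact ⟨hi, by_contra fun h => h₁ ⟨hi, h⟩⟩

/-- Almost everywhere there is at most one subgradient, and it is given by a Borel map. -/
theorem exists_measurable_ae_eq_subgradient (φ : E → ℝ) (A : Set E) :
    ∃ T : E → E, Measurable T ∧
      ∀ᵐ x : E, x ∈ A → ∀ p, IsSubgradientOn φ A x p → p = T x := by
  let G := {q : E × E // q.1 ∈ A ∧ IsSubgradientOn φ A q.1 q.2}
  rcases isEmpty_or_nonempty G with hG | hG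
  · exact ⟨id, measurable_id, Filter.Eventually.of_forall fun x hx p hp =>
      (hG.false ⟨(x, p), hx, hp⟩).elim⟩
  -- `φ` need not be convex or measurable; `g`, the supremum of the affine functions supporting `φ`
  -- at points of `A`, is a convex replacement that agrees with `φ` wherever a subgradient exists.
  let D : Set E := {z | BddAbove (Set.range fun q : G =>
    φ q.1.1 + inner ℝ q.1.2 (z - q.1.1))}
  let g : E → ℝ := fun z => ⨆ q : G, (φ q.1.1 + inner ℝ q.1.2 (z - q.1.1))
  have hg : ConvexOn ℝ D g :=
    convexOn_iSup_affine (fun q : G => φ q.1.1) (fun q => q.1.1) (fun q => q.1.2)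
  have hAD : A ⊆ D := by
    intro z hz
    refine ⟨φ z, ?_⟩
    rintro _ ⟨q, rfl⟩
    exact q.2.2 z hz
  refine ⟨fun x => (InnerProductSpace.toDual ℝ E).symm (fderiv ℝ g x),
    (InnerProductSpace.toDual ℝ E).symm.continuous.measurable.comp (measurable_fderiv ℝ g), ?_⟩
  filter_upwards [hg.ae_differentiableAt] with x hx hxA p hp
  obtain ⟨hxi, hd⟩ := hx (hAD hxA)
  have hle : ∀ z ∈ D, φ x + inner ℝ p (z - x) ≤ g z := fun z hz =>
    le_ciSup (f := fun q : G => φ q.1.1 + inner ℝ q.1.2 (z - q.1.1)) hz ⟨(x, p), hxA, hp⟩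
  have hgx : g x = φ x := by
    refine le_antisymm (ciSup_le fun q => q.2.2 x hxA) ?_
    simpa using hle x (hAD hxA)
  -- The affine function with slope `p` touches `g` from below at `x`, so `p` must be the gradient
  -- of `g` there.
  have hmin : IsLocalMin (fun z => g z - inner ℝ p z) x := by
    filter_upwards [mem_interior_iff_mem_nhds.1 hxi] with z hz
    have := hle z hz
    rw [inner_sub_right] at this
    linarith
  have hderiv : HasFDerivAt (fun z => g z - inner ℝ p z) (fderiv ℝ g x - innerSL ℝ p) x :=
    hd.hasFDerivAt.sub (innerSL ℝ p).hasFDerivAt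
  have h0 := hmin.hasFDerivAt_eq_zero hderiv
  rw [LinearIsometryEquiv.eq_symm_apply]
  rw [sub_eq_zero] at h0
  rw [h0]
  ext y
  simp

end Subgradient

/-! ### Optimality and uniqueness of convex gradients -/

section Optimality

variable {E : Type*} [NormedAddCommGroup E] [InnerProductSpace ℝ E]
  [MeasurableSpace E]

theorem MeasureTheory.MemLp.lintegral_enorm_sq {α F : Type*} [MeasurableSpace α] {μ : Measure α}
    [NormedAddCommGroup F] {f : α → F} (hf : MemLp f 2 μ) :
    ∫⁻ x, ‖f x‖ₑ ^ 2 ∂μ = ENNReal.ofReal (∫ x, ‖f x‖ ^ 2 ∂μ) := by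
  rw [ofReal_integral_eq_lintegral_ofReal (hf.integrable_norm_pow two_ne_zero) (ae_of_all _ fun x => by positivity)]
  refine lintegral_congr fun x => ?_
  rw [ENNReal.ofReal_pow (norm_nonneg _), ofReal_norm]

theorem lintegral_enorm_sq_lt_top_iff_memLp {α F : Type*} [MeasurableSpace α] {μ : Measure α}
    [NormedAddCommGroup F] {f : α → F} (hf : AEStronglyMeasurable f μ) :
    ∫⁻ x, ‖f x‖ₑ ^ 2 ∂μ < ∞ ↔ MemLp f 2 μ := by
  rw [MemLp, and_iff_right hf,
    eLpNorm_lt_top_iff_lintegral_rpow_enorm_lt_top two_ne_zero ENNReal.ofNat_ne_top]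
  simp

theorem MeasureTheory.MemLp.integrable_inner' {α F : Type*} [MeasurableSpace α] {μ : Measure α}
    [NormedAddCommGroup F] [InnerProductSpace ℝ F] {f g : α → F}
    (hf : MemLp f 2 μ) (hg : MemLp g 2 μ) : Integrable (fun x => inner ℝ (f x) (g x)) μ := by
  refine (hf.norm.integrable_mul hg.norm).mono (hf.1.inner hg.1) (ae_of_all _ fun x => ?_)
  simpa using norm_inner_le_norm (𝕜 := ℝ) (f x) (g x)

/-- The integral of the inner product against a convex gradient dominates that against any other
map with the same law, and equality forces the other map to be a selection of subgradients. -/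
theorem integral_inner_le_of_isSubgradientOn [BorelSpace E] {μ : Measure E} [IsProbabilityMeasure μ] {T S : E → E}
    (hT : Measurable T) (hS : Measurable S) (hTS : μ.map S = μ.map T)
    (hμ : MemLp id 2 μ) (hT2 : MemLp T 2 μ) (hS2 : MemLp S 2 μ)
    {φ : E → ℝ} {A : Set E} (hA : ∀ᵐ x ∂μ, x ∈ A) (h : ∀ x ∈ A, IsSubgradientOn φ A x (T x)) :
    ∫ x, inner ℝ x (S x) ∂μ ≤ ∫ x, inner ℝ x (T x) ∂μ ∧
      (∫ x, inner ℝ x (S x) ∂μ = ∫ x, inner ℝ x (T x) ∂μ →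
        ∀ᵐ x ∂μ, IsSubgradientOn φ A x (S x)) := by
  obtain ⟨x₀, hx₀⟩ := hA.exists
  -- The convex conjugate of `φ` relative to `A`. With values in `EReal` it is lower semicontinuous,
  -- hence measurable although `A` may be uncountable.
  let ψ : E → EReal := fun y => ⨆ x : A, ((inner ℝ x.1 y - φ x.1 : ℝ) : EReal)
  have hψm : Measurable ψ := by
    refine (lowerSemicontinuous_iSup fun x : A => Continuous.lowerSemicontinuous ?_).measurable
    exact continuous_coe_real_ereal.comp (by fun_prop)
  let ψr : E → ℝ := fun y => (ψ y).toReal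
  have hψrm : Measurable ψr := hψm.ereal_toReal
  have hψT : ∀ x ∈ A, ψ (T x) = ((inner ℝ x (T x) - φ x : ℝ) : EReal) := by
    intro x hx
    refine le_antisymm (iSup_le fun z => ?_) (le_iSup_of_le ⟨x, hx⟩ le_rfl)
    rw [EReal.coe_le_coe_iff]
    have := h x hx z.1 z.2
    rw [inner_sub_right, real_inner_comm, real_inner_comm (x := x)] at this
    linarith
  have hψrT : ∀ x ∈ A, ψr (T x) = inner ℝ x (T x) - φ x := by
    intro x hx
    simp only [ψr, hψT x hx, EReal.toReal_coe]
  have hfin : ∀ᵐ x ∂μ, ψ (S x) ≠ ⊤ := by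
    have h1 : ∀ᵐ y ∂(μ.map T), ψ y ≠ ⊤ := by
      refine (ae_map_iff hT.aemeasurable (hψm (measurableSet_singleton ⊤)).compl).2 ?_
      filter_upwards [hA] with x hx
      simp only [hψT x hx, Set.mem_preimage, Set.mem_singleton_iff]
      exact EReal.coe_ne_top _
    rw [← hTS] at h1
    exact ae_of_ae_map hS.aemeasurable h1
  have hψrS : ∀ᵐ x ∂μ, ∀ z ∈ A, inner ℝ z (S x) - φ z ≤ ψr (S x) := by
    filter_upwards [hfin] with x hx z hz
    have hz' : ((inner ℝ z (S x) - φ z : ℝ) : EReal) ≤ ψ (S x) := le_iSup_of_le ⟨z, hz⟩ le_rfl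
    have := EReal.toReal_le_toReal hz' (EReal.coe_ne_bot _) hx
    rwa [EReal.toReal_coe] at this
  have hip : ∀ {R R' : E → E}, MemLp R 2 μ → MemLp R' 2 μ →
      Integrable (fun x => inner ℝ (R x) (R' x)) μ := fun hR hR' => hR.integrable_inner' hR'
  have hxT : Integrable (fun x => inner ℝ x (T x)) μ := hip hμ hT2
  have hxS : Integrable (fun x => inner ℝ x (S x)) μ := hip hμ hS2
  -- The lower bound is the term of `x₀` in the supremum; the upper bound is the subgradient
  -- inequality at `x₀`.
  have hψi : Integrable (fun x => ψr (T x)) μ := by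
    refine integrable_of_le_of_le (hψrm.comp hT).aestronglyMeasurable
      (g₁ := fun x => inner ℝ x₀ (T x) - φ x₀)
      (g₂ := fun x => inner ℝ x (T x) - φ x₀ - inner ℝ (T x₀) (x - x₀)) ?_ ?_ ?_ ?_
    · filter_upwards [hA] with x hx
      rw [hψrT x hx]
      have := h x hx x₀ hx₀
      rw [inner_sub_right, real_inner_comm, real_inner_comm (x := x)] at this
      linarith
    · filter_upwards [hA] with x hx
      rw [hψrT x hx]
      have := h x₀ hx₀ x hx
      linarith
    · exact (hip (memLp_const x₀) hT2).sub (integrable_const _)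
    · exact (hxT.sub (integrable_const _)).sub
        (hip (memLp_const (T x₀)) (hμ.sub (memLp_const x₀)))
  have hψν : Integrable ψr (μ.map T) :=
    (integrable_map_measure hψrm.aestronglyMeasurable hT.aemeasurable).2 hψi
  have hψS : Integrable (fun x => ψr (S x)) μ :=
    (integrable_map_measure hψrm.aestronglyMeasurable hS.aemeasurable).1 (hTS ▸ hψν)
  have heq : ∫ x, ψr (S x) ∂μ = ∫ x, ψr (T x) ∂μ := by
    rw [← integral_map hS.aemeasurable hψrm.aestronglyMeasurable, hTS,
      integral_map hT.aemeasurable hψrm.aestronglyMeasurable]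
  -- The Fenchel–Young gap `φ x + ψ (S x) - ⟪x, S x⟫`, with `φ x` written as `⟪x, T x⟫ - ψ (T x)`
  -- because `φ` may fail to be measurable. Where it vanishes, `S x` is a subgradient at `x`.
  let D : E → ℝ := fun x => inner ℝ x (T x) - ψr (T x) + ψr (S x) - inner ℝ x (S x)
  have hD : ∫ x, D x ∂μ = ∫ x, inner ℝ x (T x) ∂μ - ∫ x, inner ℝ x (S x) ∂μ := by
    simp only [D]
    have e1 := integral_sub ((hxT.sub hψi).add hψS) hxS
    have e2 := integral_add (hxT.sub hψi) hψS
    have e3 := integral_sub hxT hψi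
    simp only [Pi.add_apply, Pi.sub_apply] at e1 e2 e3
    rw [e1, e2, e3, heq]
    ring
  have hDi : Integrable D μ := ((hxT.sub hψi).add hψS).sub hxS
  have hD0 : 0 ≤ᵐ[μ] D := by
    filter_upwards [hA, hψrS] with x hx hx'
    have := hx' x hx
    simp only [D, hψrT x hx, Pi.zero_apply]
    linarith
  refine ⟨?_, fun hE => ?_⟩
  · have := integral_nonneg_of_ae hD0
    linarith
  · have hz : D =ᵐ[μ] 0 := (integral_eq_zero_iff_of_nonneg_ae hD0 hDi).1 (by rw [hD, hE, sub_self])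
    filter_upwards [hA, hψrS, hz] with x hx hx' hxz z hz
    have h1 := hx' z hz
    simp only [D, hψrT x hx, Pi.zero_apply] at hxz
    rw [inner_sub_right, real_inner_comm, real_inner_comm (x := x)]
    linarith

theorem integral_norm_sub_sq {μ : Measure E} {S : E → E} (hμ : MemLp id 2 μ) (hS2 : MemLp S 2 μ) :
    ∫ x, ‖S x - x‖ ^ 2 ∂μ =
      ∫ x, ‖S x‖ ^ 2 ∂μ + ∫ x, ‖x‖ ^ 2 ∂μ - 2 * ∫ x, inner ℝ x (S x) ∂μ := by
  have h1 : Integrable (fun x => ‖S x‖ ^ 2) μ := hS2.integrable_norm_pow two_ne_zero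
  have h2 : Integrable (fun x => ‖x‖ ^ 2) μ := hμ.integrable_norm_pow two_ne_zero
  have h3 : Integrable (fun x => inner ℝ x (S x)) μ := hμ.integrable_inner' hS2
  have e := integral_sub (h1.add h2) (h3.const_mul 2)
  simp only [Pi.add_apply] at e
  rw [← integral_const_mul, ← integral_add h1 h2, ← e]
  refine integral_congr_ae (ae_of_all _ fun x => ?_)
  simp only
  rw [norm_sub_sq_real, real_inner_comm]
  ring

theorem MeasureTheory.MemLp.of_map_eq {α F : Type*} [MeasurableSpace α] {μ : Measure α}
    [NormedAddCommGroup F] [MeasurableSpace F] [BorelSpace F] [SecondCountableTopology F]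
    {T S : α → F} (hT2 : MemLp T 2 μ) (hT : Measurable T) (hS : Measurable S) (hTS : μ.map S = μ.map T) : MemLp S 2 μ := by
  have h : MemLp id 2 (μ.map T) :=
    (memLp_map_measure_iff measurable_id.aestronglyMeasurable hT.aemeasurable).2 hT2
  rw [← hTS] at h
  exact (memLp_map_measure_iff measurable_id.aestronglyMeasurable hS.aemeasurable).1 h

/-- `S` and `T` have equal second moments, so the costs differ only in the correlation terms. -/
theorem integral_norm_sub_sq_sub_of_map_eq [BorelSpace E] [SecondCountableTopology E]
    {μ : Measure E} {T S : E → E}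
    (hT : Measurable T) (hS : Measurable S) (hTS : μ.map S = μ.map T)
    (hμ : MemLp id 2 μ) (hT2 : MemLp T 2 μ) :
    ∫ x, ‖S x - x‖ ^ 2 ∂μ - ∫ x, ‖T x - x‖ ^ 2 ∂μ =
      2 * (∫ x, inner ℝ x (T x) ∂μ - ∫ x, inner ℝ x (S x) ∂μ) := by
  have hm : AEStronglyMeasurable (fun y : E => ‖y‖ ^ 2) (μ.map T) :=
    (measurable_norm.pow_const 2).aestronglyMeasurable
  have : ∫ x, ‖S x‖ ^ 2 ∂μ = ∫ x, ‖T x‖ ^ 2 ∂μ := by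
    rw [← integral_map (f := fun y : E => ‖y‖ ^ 2) hS.aemeasurable (hTS ▸ hm), hTS,
      integral_map hT.aemeasurable hm]
  rw [integral_norm_sub_sq hμ (hT2.of_map_eq hT hS hTS), integral_norm_sub_sq hμ hT2, this]
  ring

theorem IsConvexGradient.lintegral_cost_le [BorelSpace E] [SecondCountableTopology E]
    {μ : Measure E} [IsProbabilityMeasure μ] {T S : E → E}
    (h : IsConvexGradient μ T) (hT : Measurable T) (hS : Measurable S) (hTS : μ.map S = μ.map T)
    (hμ : MemLp id 2 μ) (hT2 : MemLp T 2 μ) :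
    ∫⁻ x, ‖T x - x‖ₑ ^ 2 ∂μ ≤ ∫⁻ x, ‖S x - x‖ₑ ^ 2 ∂μ := by
  obtain ⟨φ, A, hA, hsub⟩ := h
  have hS2 := hT2.of_map_eq hT hS hTS
  have h1 := (integral_inner_le_of_isSubgradientOn hT hS hTS hμ hT2 hS2 hA hsub).1
  have h2 := integral_norm_sub_sq_sub_of_map_eq hT hS hTS hμ hT2
  rw [MemLp.lintegral_enorm_sq (f := fun x => T x - x) (hT2.sub hμ),
    MemLp.lintegral_enorm_sq (f := fun x => S x - x) (hS2.sub hμ)]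
  exact ENNReal.ofReal_le_ofReal (by linarith)

theorem IsConvexGradient.congr {μ : Measure E} {T S : E → E} (h : IsConvexGradient μ T)
    (hST : S =ᵐ[μ] T) : IsConvexGradient μ S := by
  obtain ⟨φ, A, hA, hsub⟩ := h
  refine ⟨φ, {x ∈ A | S x = T x}, by filter_upwards [hA, hST] with x h1 h2 using ⟨h1, h2⟩, ?_⟩
  rintro x ⟨hx, hxe⟩ z ⟨hz, -⟩
  rw [hxe]
  exact hsub x hx z hz

/-- Subgradient inequalities can be added with nonnegative weights, on the intersection of the
finitely many sets of full measure. -/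
theorem IsConvexGradient.sum_smul {ι : Type*} [Fintype ι] {μ : Measure E}
    {T : ι → E → E} (h : ∀ i, IsConvexGradient μ (T i)) {w : ι → ℝ} (hw : ∀ i, 0 ≤ w i) :
    IsConvexGradient μ (fun x => ∑ i, w i • T i x) := by
  choose φ A hA hsub using h
  refine ⟨fun x => ∑ i, w i * φ i x, ⋂ i, A i, ?_, fun x hx z hz => ?_⟩
  · filter_upwards [ae_all_iff.2 hA] with x hx using Set.mem_iInter.2 hx
  · simp only
    rw [sum_inner, ← Finset.sum_add_distrib]
    refine Finset.sum_le_sum fun i _ => ?_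
    rw [real_inner_smul_left, ← mul_add]
    exact mul_le_mul_of_nonneg_left
      (hsub i x (Set.mem_iInter.1 hx i) z (Set.mem_iInter.1 hz i)) (hw i)

/-- Uniqueness in Brenier's theorem: a transport map whose cost is at most that of a convex
gradient with the same image measure coincides with it almost everywhere. -/
theorem IsConvexGradient.ae_eq_of_cost_le [FiniteDimensional ℝ E] [BorelSpace E] {μ : Measure E}
    [IsProbabilityMeasure μ] (hac : μ ≪ volume) {T S : E → E}
    (h : IsConvexGradient μ T) (hT : Measurable T) (hS : Measurable S) (hTS : μ.map S = μ.map T)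
    (hμ : MemLp id 2 μ) (hT2 : MemLp T 2 μ)
    (hle : ∫⁻ x, ‖S x - x‖ₑ ^ 2 ∂μ ≤ ∫⁻ x, ‖T x - x‖ₑ ^ 2 ∂μ) : S =ᵐ[μ] T := by
  obtain ⟨φ, A, hA, hsub⟩ := h
  have hS2 := hT2.of_map_eq hT hS hTS
  obtain ⟨h1, h1'⟩ := integral_inner_le_of_isSubgradientOn hT hS hTS hμ hT2 hS2 hA hsub
  have h2 := integral_norm_sub_sq_sub_of_map_eq hT hS hTS hμ hT2
  rw [MemLp.lintegral_enorm_sq (f := fun x => T x - x) (hT2.sub hμ),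
    MemLp.lintegral_enorm_sq (f := fun x => S x - x) (hS2.sub hμ),
    ENNReal.ofReal_le_ofReal_iff (integral_nonneg fun x => by positivity)] at hle
  obtain ⟨R, -, hR⟩ := exists_measurable_ae_eq_subgradient φ A
  filter_upwards [hA, h1' (by linarith), hac.ae_le hR] with x hx hxS hxR
  rw [hxR hx _ hxS, hxR hx _ (hsub x hx)]

end Optimality

/-! ### Existence of optimal couplings -/

section Kantorovich

open scoped NNReal

/-- The integral of each truncation `min c n` is weakly continuous, and a supremum of continuous
functions is lower semicontinuous. -/
theorem lowerSemicontinuous_lintegral_of_continuous {Ω : Type*} [TopologicalSpace Ω]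
    [MeasurableSpace Ω] [OpensMeasurableSpace Ω] {c : Ω → ℝ≥0} (hc : Continuous c) :
    LowerSemicontinuous fun γ : ProbabilityMeasure Ω => ∫⁻ z, c z ∂(γ : Measure Ω) := by
  have h : ∀ γ : ProbabilityMeasure Ω, ∫⁻ z, c z ∂(γ : Measure Ω) =
      ⨆ n : ℕ, ∫⁻ z, (min (c z) n : ℝ≥0) ∂(γ : Measure Ω) := by
    intro γ
    rw [← lintegral_iSup]
    · refine lintegral_congr fun z => le_antisymm ?_ (iSup_le fun n => ?_)
      · obtain ⟨n, hn⟩ := exists_nat_ge (c z)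
        exact le_iSup_of_le n (by rw [min_eq_left hn])
      · exact ENNReal.coe_le_coe.2 (min_le_left _ _)
    · exact fun n => (hc.min continuous_const).measurable.coe_nnreal_ennreal
    · intro n m hnm z
      have : (n : ℝ≥0) ≤ m := by exact_mod_cast hnm
      exact ENNReal.coe_le_coe.2 (min_le_min_left _ this)
  simp_rw [h]
  refine lowerSemicontinuous_iSup fun n => Continuous.lowerSemicontinuous ?_
  let f : BoundedContinuousFunction Ω ℝ≥0 :=
    BoundedContinuousFunction.mkOfBound ⟨fun z => min (c z) n, hc.min continuous_const⟩ n
      (fun x y => by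
        have h0 : ∀ z, ((min (c z) n : ℝ≥0) : ℝ) ∈ Set.Icc (0 : ℝ) n := fun z =>
          ⟨NNReal.coe_nonneg _, by exact_mod_cast min_le_right (c z) (n : ℝ≥0)⟩
        have := Real.dist_le_of_mem_Icc (h0 x) (h0 y)
        simpa [NNReal.dist_eq, Real.dist_eq] using this)
  rw [continuous_iff_continuousAt]
  intro γ
  exact ProbabilityMeasure.tendsto_iff_forall_lintegral_tendsto.1 Filter.tendsto_id f

/-- Direct method: couplings of fixed marginals form a tight closed set, compact by Prokhorov's
theorem. -/
theorem exists_isMinOn_coupling {X Y : Type*}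
    [TopologicalSpace X] [MeasurableSpace X] [BorelSpace X] [PolishSpace X]
    [TopologicalSpace Y] [MeasurableSpace Y] [BorelSpace Y] [PolishSpace Y]
    (μ : Measure X) [IsProbabilityMeasure μ] (ν : Measure Y) [IsProbabilityMeasure ν]
    {c : X × Y → ℝ≥0} (hc : Continuous c) :
    ∃ γ : Measure (X × Y), IsProbabilityMeasure γ ∧ γ.fst = μ ∧ γ.snd = ν ∧
      ∀ γ' : Measure (X × Y), IsProbabilityMeasure γ' → γ'.fst = μ → γ'.snd = ν →
        ∫⁻ z, c z ∂γ ≤ ∫⁻ z, c z ∂γ' := by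
  let C : Set (ProbabilityMeasure (X × Y)) :=
    {γ | (γ : Measure (X × Y)).fst = μ ∧ (γ : Measure (X × Y)).snd = ν}
  have hne : C.Nonempty :=
    ⟨⟨μ.prod ν, inferInstance⟩, Measure.fst_prod, Measure.snd_prod⟩
  have htight :
      IsTightMeasureSet {((γ : ProbabilityMeasure (X × Y)) : Measure (X × Y)) | γ ∈ C} := by
    refine IsTightMeasureSet.prodMk ((isTightMeasureSet_singleton (μ := μ)).subset ?_)
      ((isTightMeasureSet_singleton (μ := ν)).subset ?_)
    · rintro _ ⟨_, ⟨γ, hγ, rfl⟩, rfl⟩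
      exact hγ.1
    · rintro _ ⟨_, ⟨γ, hγ, rfl⟩, rfl⟩
      exact hγ.2
  have hclosed : IsClosed C := by
    have h1 : IsClosed {γ : ProbabilityMeasure (X × Y) |
        γ.map (continuous_fst.measurable.aemeasurable) =
          (⟨μ, inferInstance⟩ : ProbabilityMeasure X)} :=
      isClosed_eq (ProbabilityMeasure.continuous_map continuous_fst) continuous_const
    have h2 : IsClosed {γ : ProbabilityMeasure (X × Y) |
        γ.map (continuous_snd.measurable.aemeasurable) =
          (⟨ν, inferInstance⟩ : ProbabilityMeasure Y)} :=
      isClosed_eq (ProbabilityMeasure.continuous_map continuous_snd) continuous_const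
    convert h1.inter h2 using 1
    ext γ
    exact and_congr ⟨fun h => Subtype.ext h, fun h => congrArg Subtype.val h⟩
      ⟨fun h => Subtype.ext h, fun h => congrArg Subtype.val h⟩
  have hcomp : IsCompact C := by
    have := isCompact_closure_of_isTightMeasureSet htight
    rwa [hclosed.closure_eq] at this
  obtain ⟨γ, hγ, hmin⟩ :=
    ((lowerSemicontinuous_lintegral_of_continuous hc).lowerSemicontinuousOn C).exists_isMinOn
      hne hcomp
  exact ⟨γ, inferInstance, hγ.1, hγ.2, fun γ' h h1 h2 => hmin (a := ⟨γ', h⟩) ⟨h1, h2⟩⟩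

end Kantorovich

/-! ### Cyclical monotonicity of optimal couplings -/

section CyclicalMonotonicity

open ProbabilityTheory

theorem ProbabilityTheory.cond_le_inv_smul {Ω : Type*} [MeasurableSpace Ω] (γ : Measure Ω)
    (s : Set Ω) : γ[|s] ≤ (γ s)⁻¹ • γ := by
  unfold cond
  gcongr
  exact Measure.restrict_le_self

/-- The support of an optimal coupling with finite cost is cyclically monotone. -/
theorem sum_cost_le_of_mem_support {X Y : Type*}
    [TopologicalSpace X] [MeasurableSpace X] [BorelSpace X] [SecondCountableTopology X]
    [TopologicalSpace Y] [MeasurableSpace Y] [BorelSpace Y] [SecondCountableTopology Y]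
    {γ : Measure (X × Y)} [IsProbabilityMeasure γ] {c : X × Y → ℝ} (hc : Continuous c)
    (hc0 : ∀ z, 0 ≤ c z)
    (hfin : ∫⁻ z, ENNReal.ofReal (c z) ∂γ ≠ ∞)
    (hmin : ∀ γ' : Measure (X × Y), IsProbabilityMeasure γ' → γ'.fst = γ.fst → γ'.snd = γ.snd →
        ∫⁻ z, ENNReal.ofReal (c z) ∂γ ≤ ∫⁻ z, ENNReal.ofReal (c z) ∂γ')
    {ι : Type*} [Fintype ι] (z : ι → X × Y) (hz : ∀ i, z i ∈ γ.support) (σ : Equiv.Perm ι) :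
    ∑ i, c (z i) ≤ ∑ i, c ((z i).1, (z (σ i)).2) := by
  classical
  by_contra! hlt
  have hopen : IsOpen {u : ι → X × Y | ∑ i, c ((u i).1, (u (σ i)).2) < ∑ i, c (u i)} :=
    isOpen_lt (by fun_prop) (by fun_prop)
  obtain ⟨B, hB, hBsub⟩ := isOpen_pi_iff'.1 hopen z hlt
  have hpos : ∀ i, γ (B i) ≠ 0 := fun i =>
    ((Measure.mem_support_iff_forall _).1 (hz i) (B i) ((hB i).1.mem_nhds (hB i).2)).ne'
  have : ∀ i, IsProbabilityMeasure (γ[|B i]) := fun i => cond_isProbabilityMeasure (hpos i)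
  -- Independent draws `u i` from `γ` near each `z i`; exchanging second coordinates by `σ` strictly
  -- lowers the total cost of almost every draw.
  let P : Measure (ι → X × Y) := Measure.pi fun i => γ[|B i]
  have hPB : ∀ᵐ u ∂P, ∑ i, c ((u i).1, (u (σ i)).2) < ∑ i, c (u i) := by
    have : ∀ᵐ u ∂P, ∀ i, u i ∈ B i := ae_all_iff.2 fun i =>
      (measurePreserving_eval (fun i => γ[|B i]) i).quasiMeasurePreserving.ae
        (ae_cond_mem (hB i).1.measurableSet)
    filter_upwards [this] with u hu
    exact hBsub fun i _ => hu i
  have hι : Nonempty ι := by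
    by_contra h
    rw [not_nonempty_iff] at h
    simp at hlt
  -- Scaling by `κ⁻¹` makes `η ≤ γ`, since `γ[|B i] ≤ (γ (B i))⁻¹ • γ`. The competitor replaces the
  -- part `η` of `γ` by its rearrangement `η'`, which has the same marginals.
  let κ : ℝ≥0∞ := ∑ i, (γ (B i))⁻¹
  have hκ0 : κ ≠ 0 := by
    obtain ⟨i⟩ := hι
    intro h
    exact ENNReal.inv_ne_zero.2 (measure_ne_top γ (B i))
      (Finset.sum_eq_zero_iff.1 h i (Finset.mem_univ i))
  have hκt : κ ≠ ∞ := ENNReal.sum_ne_top.2 fun i _ => ENNReal.inv_ne_top.2 (hpos i)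
  let η : Measure (X × Y) := κ⁻¹ • ∑ i, γ[|B i]
  have hη : η ≤ γ := by
    have h1 : ∑ i, γ[|B i] ≤ κ • γ := by
      rw [Finset.sum_smul]
      exact Finset.sum_le_sum fun i _ => cond_le_inv_smul γ (B i)
    calc η ≤ κ⁻¹ • (κ • γ) := by
          simp only [η]
          gcongr
      _ = γ := by rw [smul_smul, ENNReal.inv_mul_cancel hκ0 hκt, one_smul]
  have : IsFiniteMeasure η := isFiniteMeasure_of_le γ hη
  let ρ : Measure (X × Y) := γ - η
  have hρ : ρ + η = γ := Measure.sub_add_cancel_of_le hη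
  let f : ι → (ι → X × Y) → X × Y := fun i u => ((u i).1, (u (σ i)).2)
  have hf : ∀ i, Measurable (f i) := fun i => by fun_prop
  let η' : Measure (X × Y) := κ⁻¹ • ∑ i, P.map (f i)
  have hev : ∀ i, P.map (fun u => u i) = γ[|B i] := fun i =>
    (measurePreserving_eval (fun i => γ[|B i]) i).map_eq
  have hfst : η'.fst = η.fst := by
    simp only [η, η', Measure.fst, Measure.map_smul]
    rw [← Measure.mapₗ_apply_of_measurable measurable_fst,
      ← Measure.mapₗ_apply_of_measurable measurable_fst, map_sum, map_sum]
    congr 1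
    refine Finset.sum_congr rfl fun i _ => ?_
    rw [Measure.mapₗ_apply_of_measurable measurable_fst,
      Measure.mapₗ_apply_of_measurable measurable_fst,
      Measure.map_map measurable_fst (hf i), ← hev i,
      Measure.map_map measurable_fst (measurable_pi_apply i)]
    rfl
  have hsnd : η'.snd = η.snd := by
    simp only [η, η', Measure.snd, Measure.map_smul]
    rw [← Measure.mapₗ_apply_of_measurable measurable_snd,
      ← Measure.mapₗ_apply_of_measurable measurable_snd, map_sum, map_sum]
    congr 1
    rw [← Equiv.sum_comp σ fun i => (Measure.mapₗ Prod.snd) (γ[|B i])]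
    refine Finset.sum_congr rfl fun i _ => ?_
    rw [Measure.mapₗ_apply_of_measurable measurable_snd,
      Measure.mapₗ_apply_of_measurable measurable_snd,
      Measure.map_map measurable_snd (hf i), ← hev (σ i),
      Measure.map_map measurable_snd (measurable_pi_apply (σ i))]
    rfl
  have hfst' : (ρ + η').fst = γ.fst := by
    rw [← hρ, Measure.fst_add, Measure.fst_add, hfst]
  have hsnd' : (ρ + η').snd = γ.snd := by
    rw [← hρ, Measure.snd_add, Measure.snd_add, hsnd]
  have hprob : IsProbabilityMeasure (ρ + η') :=
    ⟨by rw [← Measure.fst_univ, hfst', Measure.fst_univ, measure_univ]⟩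
  have hle := hmin (ρ + η') hprob hfst' hsnd'
  have hcm : Measurable fun z => ENNReal.ofReal (c z) := hc.measurable.ennreal_ofReal
  have hηc : ∫⁻ z, ENNReal.ofReal (c z) ∂η = κ⁻¹ * ∫⁻ u, ENNReal.ofReal (∑ i, c (u i)) ∂P := by
    simp only [η, lintegral_smul_measure, lintegral_finsetSum_measure, smul_eq_mul]
    congr 1
    simp_rw [ENNReal.ofReal_sum_of_nonneg fun i _ => hc0 _]
    rw [lintegral_finsetSum]
    · refine Finset.sum_congr rfl fun i _ => ?_
      rw [← hev i, lintegral_map hcm (measurable_pi_apply i)]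
    · exact fun i _ => hcm.comp (measurable_pi_apply i)
  have hηc' : ∫⁻ z, ENNReal.ofReal (c z) ∂η' =
      κ⁻¹ * ∫⁻ u, ENNReal.ofReal (∑ i, c ((u i).1, (u (σ i)).2)) ∂P := by
    simp only [η', lintegral_smul_measure, lintegral_finsetSum_measure, smul_eq_mul]
    congr 1
    simp_rw [ENNReal.ofReal_sum_of_nonneg fun i _ => hc0 _]
    rw [lintegral_finsetSum]
    · refine Finset.sum_congr rfl fun i _ => ?_
      rw [lintegral_map hcm (hf i)]
    · exact fun i _ => hcm.comp (hf i)
  have hρη : ∫⁻ z, ENNReal.ofReal (c z) ∂γ =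
      ∫⁻ z, ENNReal.ofReal (c z) ∂ρ + ∫⁻ z, ENNReal.ofReal (c z) ∂η := by
    rw [← lintegral_add_measure, hρ]
  rw [lintegral_add_measure, hρη] at hle
  rw [hρη] at hfin
  have hle' := (ENNReal.add_le_add_iff_left (ENNReal.add_ne_top.1 hfin).1).1 hle
  have hκi0 : κ⁻¹ ≠ 0 := ENNReal.inv_ne_zero.2 hκt
  have hκit : κ⁻¹ ≠ ∞ := ENNReal.inv_ne_top.2 hκ0
  rw [hηc, hηc', ENNReal.mul_le_mul_iff_right hκi0 hκit] at hle'
  refine hle'.not_gt ?_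
  have hPfin : ∫⁻ u, ENNReal.ofReal (∑ i, c (u i)) ∂P ≠ ∞ := by
    intro h
    have := (ENNReal.add_ne_top.1 hfin).2
    rw [hηc, h, ENNReal.mul_top hκi0] at this
    exact this rfl
  have hlt_ae : ∀ᵐ u ∂P, ENNReal.ofReal (∑ i, c ((u i).1, (u (σ i)).2)) <
      ENNReal.ofReal (∑ i, c (u i)) := by
    filter_upwards [hPB] with u hu
    exact (ENNReal.ofReal_lt_ofReal_iff_of_nonneg (Finset.sum_nonneg fun i _ => hc0 _)).2 hu
  refine lintegral_strict_mono (NeZero.ne P) ?_ ?_ hlt_ae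
  · exact (Finset.measurable_sum _ fun i _ =>
      hc.measurable.comp (measurable_pi_apply i)).ennreal_ofReal.aemeasurable
  · exact ne_top_of_le_ne_top hPfin (lintegral_mono_ae (hlt_ae.mono fun u hu => hu.le))

end CyclicalMonotonicity

/-! ### Rockafellar's potential -/

section Rockafellar

variable {E : Type*} [NormedAddCommGroup E] [InnerProductSpace ℝ E]

/-- The value at `x` of the affine function attached to the first `n + 1` terms of a sequence of
points and slopes, as in Rockafellar's construction of a potential. -/
noncomputable def chainAffine (s : ℕ → E × E) (n : ℕ) (x : E) : ℝ :=
  ∑ i ∈ Finset.range n, inner ℝ (s i).2 ((s (i + 1)).1 - (s i).1) + inner ℝ (s n).2 (x - (s n).1)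

theorem chainAffine_append (s : ℕ → E × E) (n : ℕ) (z : E × E) (x : E) :
    chainAffine (fun i => if i ≤ n then s i else z) (n + 1) x =
      chainAffine s n z.1 + inner ℝ z.2 (x - z.1) := by
  simp only [chainAffine, Finset.sum_range_succ]
  rw [if_pos le_rfl, if_neg (by omega)]
  congr 2
  refine Finset.sum_congr rfl fun i hi => ?_
  have := Finset.mem_range.1 hi
  rw [if_pos (by omega), if_pos (by omega)]

theorem chainAffine_closed_nonpos {Γ : Set (E × E)}
    (hΓ : ∀ (n : ℕ) (z : Fin n → E × E), (∀ i, z i ∈ Γ) → ∀ σ : Equiv.Perm (Fin n),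
      ∑ i, inner ℝ (z i).1 (z (σ i)).2 ≤ ∑ i, inner ℝ (z i).1 (z i).2)
    (s : ℕ → E × E) (hs : ∀ i, s i ∈ Γ) (n : ℕ) : chainAffine s n (s 0).1 ≤ 0 := by
  -- The inverse rotation, once reindexed, pairs the point `i + 1` with the slope `i`, closing the
  -- chain into a cycle.
  have h := hΓ (n + 1) (fun i => s i) (fun i => hs i) (finRotate (n + 1)).symm
  rw [← Equiv.sum_comp (finRotate (n + 1))] at h
  simp only [Equiv.symm_apply_apply] at h
  rw [Fin.sum_univ_castSucc, Fin.sum_univ_castSucc] at h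
  simp only [Fin.val_last, Fin.val_castSucc, finRotate_apply, Fin.last_add_one,
    Fin.coeSucc_eq_succ, Fin.val_succ, Fin.val_zero] at h
  rw [Fin.sum_univ_eq_sum_range (fun i => inner ℝ (s (i + 1)).1 (s i).2) n,
    Fin.sum_univ_eq_sum_range (fun i => inner ℝ (s i).1 (s i).2) n] at h
  simp only [chainAffine, inner_sub_right, Finset.sum_sub_distrib]
  simp only [real_inner_comm] at h ⊢
  linarith

/-- Rockafellar's theorem: a cyclically monotone set is contained in a subdifferential. -/
theorem exists_isSubgradientOn_of_cyclicallyMonotone {Γ : Set (E × E)}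
    (hΓ : ∀ (n : ℕ) (z : Fin n → E × E), (∀ i, z i ∈ Γ) → ∀ σ : Equiv.Perm (Fin n),
      ∑ i, inner ℝ (z i).1 (z (σ i)).2 ≤ ∑ i, inner ℝ (z i).1 (z i).2) :
    ∃ φ : E → ℝ, ∀ z ∈ Γ, IsSubgradientOn φ (Prod.fst '' Γ) z.1 z.2 := by
  rcases Γ.eq_empty_or_nonempty with rfl | ⟨z₀, hz₀⟩
  · exact ⟨0, by simp⟩
  -- Chains in `Γ` starting at `z₀`, with a length; later terms of the sequence are irrelevant.
  let ι := {q : (ℕ → E × E) × ℕ // (∀ i, q.1 i ∈ Γ) ∧ q.1 0 = z₀}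
  have : Nonempty ι := ⟨⟨(fun _ => z₀, 0), fun _ => hz₀, rfl⟩⟩
  have hext : ∀ q : ι, ∀ z ∈ Γ, ∃ q' : ι, ∀ x,
      chainAffine q'.1.1 q'.1.2 x = chainAffine q.1.1 q.1.2 z.1 + inner ℝ z.2 (x - z.1) := by
    rintro ⟨⟨s, n⟩, hs, h0⟩ z hz
    refine ⟨⟨(fun i => if i ≤ n then s i else z, n + 1), fun i => ?_, ?_⟩,
      chainAffine_append s n z⟩
    · dsimp only
      split_ifs
      exacts [hs i, hz]
    · simpa using h0
  have hbdd : ∀ z ∈ Γ, BddAbove (Set.range fun q : ι => chainAffine q.1.1 q.1.2 z.1) := by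
    intro z hz
    -- Append `z` to a chain and return to `z₀`: the closed chain has value at most 0.
    refine ⟨- inner ℝ z.2 (z₀.1 - z.1), ?_⟩
    rintro _ ⟨q, rfl⟩
    obtain ⟨q', hq'⟩ := hext q z hz
    have h := chainAffine_closed_nonpos hΓ q'.1.1 q'.2.1 q'.1.2
    rw [q'.2.2, hq'] at h
    simp only
    linarith
  refine ⟨fun x => ⨆ q : ι, chainAffine q.1.1 q.1.2 x, ?_⟩
  rintro z hz _ ⟨z', hz', rfl⟩
  rw [← le_sub_iff_add_le]
  refine ciSup_le fun q => ?_
  obtain ⟨q', hq'⟩ := hext q z hz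
  rw [le_sub_iff_add_le, ← hq']
  exact le_ciSup (hbdd z' hz') q'

end Rockafellar

/-! ### Brenier's theorem: existence -/

section Brenier

variable {E : Type*} [NormedAddCommGroup E] [InnerProductSpace ℝ E] [FiniteDimensional ℝ E]
  [MeasurableSpace E] [BorelSpace E]

/-- The existence part of Brenier's theorem. -/
theorem exists_isConvexGradient_map_eq {μ ν : Measure E} [IsProbabilityMeasure μ]
    [IsProbabilityMeasure ν] (hac : μ ≪ volume) (hμ : MemLp id 2 μ) (hν : MemLp id 2 ν) :
    ∃ T : E → E, Measurable T ∧ μ.map T = ν ∧ IsConvexGradient μ T := by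
  have : ProperSpace E := FiniteDimensional.proper ℝ E
  have hc : Continuous fun z : E × E => ‖z.1 - z.2‖₊ ^ 2 := by fun_prop
  obtain ⟨γ, hγ, hγ1, hγ2, hmin⟩ := exists_isMinOn_coupling μ ν hc
  have hcost : ∀ z : E × E,
      ENNReal.ofReal (‖z.1 - z.2‖ ^ 2) = ((‖z.1 - z.2‖₊ ^ 2 : NNReal) : ℝ≥0∞) := by
    intro z
    rw [ENNReal.ofReal_pow (norm_nonneg _), ofReal_norm, ENNReal.coe_pow]
    rfl
  have hfin : ∫⁻ z, ENNReal.ofReal (‖z.1 - z.2‖ ^ 2) ∂γ ≠ ∞ := by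
    have h1 : MemLp (fun z : E × E => z.1) 2 γ := by
      rw [← hγ1] at hμ
      exact (memLp_map_measure_iff measurable_id.aestronglyMeasurable
        measurable_fst.aemeasurable).1 hμ
    have h2 : MemLp (fun z : E × E => z.2) 2 γ := by
      rw [← hγ2] at hν
      exact (memLp_map_measure_iff measurable_id.aestronglyMeasurable
        measurable_snd.aemeasurable).1 hν
    have h3 := (h1.sub h2).integrable_norm_pow two_ne_zero
    exact (h3.lintegral_lt_top).ne
  -- In the quadratic cost the squared norms cancel under a permutation, leaving only inner
  -- products.
  have hcyc : ∀ (n : ℕ) (z : Fin n → E × E), (∀ i, z i ∈ γ.support) → ∀ σ : Equiv.Perm (Fin n),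
      ∑ i, inner ℝ (z i).1 (z (σ i)).2 ≤ ∑ i, inner ℝ (z i).1 (z i).2 := by
    intro n z hz σ
    have h := sum_cost_le_of_mem_support (γ := γ) (c := fun z : E × E => ‖z.1 - z.2‖ ^ 2)
      (by fun_prop) (fun z => by positivity) hfin
      (fun γ' h' h1 h2 => by
        simp_rw [hcost]
        exact hmin γ' h' (h1.trans hγ1) (h2.trans hγ2)) z hz σ
    simp only [norm_sub_sq_real, Finset.sum_add_distrib, Finset.sum_sub_distrib,
      ← Finset.mul_sum] at h
    rw [Equiv.sum_comp σ fun i => ‖(z i).2‖ ^ 2] at h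
    linarith
  obtain ⟨φ, hφ⟩ := exists_isSubgradientOn_of_cyclicallyMonotone hcyc
  obtain ⟨T, hT, hTφ⟩ := exists_measurable_ae_eq_subgradient φ (Prod.fst '' γ.support)
  have hTμ := hac.ae_le hTφ
  have hgraph : ∀ᵐ z ∂γ, z ∈ γ.support ∧ z.2 = T z.1 := by
    rw [← hγ1] at hTμ
    filter_upwards [ae_of_ae_map measurable_fst.aemeasurable hTμ, γ.support_mem_ae] with z h hz
    exact ⟨hz, h ⟨z, hz, rfl⟩ _ (hφ z hz)⟩
  have hgm : Measurable fun x => (x, T x) := measurable_id.prodMk hT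
  have hmap : γ = μ.map fun x => (x, T x) := by
    have h1 : (fun z : E × E => (z.1, T z.1)) =ᵐ[γ] id := by
      filter_upwards [hgraph] with z hz
      exact Prod.ext rfl hz.2.symm
    rw [← hγ1, Measure.fst, Measure.map_map hgm measurable_fst]
    exact (Measure.map_id.symm.trans (Measure.map_congr h1.symm))
  -- The set consists of the points at which `T x` itself is known to be a subgradient.
  refine ⟨T, hT, ?_, φ, {x | (x, T x) ∈ γ.support}, ?_, ?_⟩
  · rw [← hγ2, hmap, Measure.snd, Measure.map_map measurable_snd hgm]
    rfl
  · have h : ∀ᵐ z ∂(μ.map fun x => (x, T x)), z ∈ γ.support := by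
      rw [← hmap]
      exact γ.support_mem_ae
    exact ae_of_ae_map hgm.aemeasurable h
  · intro x hx z hz
    exact hφ (x, T x) hx z ⟨_, hz, rfl⟩

end Brenier

/-! ### Transport maps onto arbitrary probability measures -/

section TransportMap

open ProbabilityTheory unitInterval

theorem ProbabilityTheory.continuous_cdf (μ : Measure ℝ) [IsProbabilityMeasure μ]
    (hμ : ∀ t, μ {t} = 0) : Continuous (cdf μ) := by
  rw [continuous_iff_continuousAt]
  intro t
  rw [(monotone_cdf μ).continuousAt_iff_leftLim_eq_rightLim, StieltjesFunction.rightLim_eq]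
  have h := hμ t
  rw [← measure_cdf μ, StieltjesFunction.measure_singleton, ENNReal.ofReal_eq_zero] at h
  exact le_antisymm ((monotone_cdf μ).leftLim_le le_rfl) (by linarith)

/-- The probability integral transform. -/
theorem exists_map_eq_volume_unitInterval (μ : Measure ℝ) [IsProbabilityMeasure μ]
    (hμ : ∀ t, μ {t} = 0) : ∃ f : ℝ → I, Measurable f ∧ μ.map f = volume := by
  let f : ℝ → I := fun x => ⟨cdf μ x, cdf_nonneg μ x, cdf_le_one μ x⟩
  have hcont := continuous_cdf μ hμ
  have hf : Measurable f := (hcont.subtype_mk _).measurable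
  refine ⟨f, hf, ?_⟩
  have : IsProbabilityMeasure (μ.map f) := Measure.isProbabilityMeasure_map hf.aemeasurable
  refine Measure.ext_of_Iic _ _ fun u => ?_
  rw [Measure.map_apply hf measurableSet_Iic, unitInterval.volume_Iic]
  have hpre : f ⁻¹' Set.Iic u = {x | cdf μ x ≤ u} := rfl
  rw [hpre]
  rcases u.2.2.eq_or_lt with hu1 | hu1
  · have : {x | cdf μ x ≤ u} = Set.univ := by
      ext x
      simp [hu1, cdf_le_one]
    rw [this, hu1, measure_univ, ENNReal.ofReal_one]
  rcases Set.eq_empty_or_nonempty {x | cdf μ x ≤ u} with he | hne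
  · have h0 : (u : ℝ) ≤ 0 := by
      refine ge_of_tendsto (tendsto_cdf_atBot μ) (Filter.Eventually.of_forall fun x => ?_)
      by_contra! h
      exact (Set.eq_empty_iff_forall_notMem.1 he x) h.le
    rw [he, measure_empty, ENNReal.ofReal_of_nonpos h0]
  · have hbdd : BddAbove {x | cdf μ x ≤ u} := by
      obtain ⟨b, hb⟩ := ((tendsto_cdf_atTop μ).eventually (lt_mem_nhds hu1)).exists
      refine ⟨b, fun x hx => ?_⟩
      by_contra! h
      exact (hb.trans_le (monotone_cdf μ h.le)).not_ge hx
    have hclosed : IsClosed {x | cdf μ x ≤ u} := isClosed_le hcont continuous_const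
    have hmem := hclosed.csSup_mem hne hbdd
    set b := sSup {x | cdf μ x ≤ u}
    have hset : {x | cdf μ x ≤ u} = Set.Iic b := by
      ext x
      exact ⟨fun hx => le_csSup hbdd hx, fun hx => (monotone_cdf μ hx).trans hmem⟩
    -- Right of `b` the cdf exceeds `u`, so continuity gives the missing inequality.
    have hb : cdf μ b = u := by
      refine le_antisymm hmem ?_
      refine ge_of_tendsto (hcont.continuousWithinAt (s := Set.Ioi b) (x := b)) ?_
      filter_upwards [self_mem_nhdsWithin] with x hx
      by_contra! h
      exact (le_csSup hbdd h.le).not_gt hx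
    rw [hset, ← ofReal_cdf, hb]

/-- Hyperplanes are null, so the first coordinate has an atomless law; its cdf makes it uniform, and
a uniform variable can be mapped to any law on a standard Borel space. -/
theorem exists_measurable_map_eq_of_absolutelyContinuous {d : ℕ} [NeZero d]
    {Y : Type*} [Nonempty Y] [MeasurableSpace Y] [StandardBorelSpace Y]
    (μ : Measure (EuclideanSpace ℝ (Fin d))) [IsProbabilityMeasure μ] (hac : μ ≪ volume)
    (ν : Measure Y) [IsProbabilityMeasure ν] :
    ∃ T : EuclideanSpace ℝ (Fin d) → Y, Measurable T ∧ μ.map T = ν := by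
  let p : EuclideanSpace ℝ (Fin d) → ℝ := fun x => x 0
  have hp : Measurable p := by fun_prop
  have : IsProbabilityMeasure (μ.map p) := Measure.isProbabilityMeasure_map hp.aemeasurable
  have hatom : ∀ t, μ.map p {t} = 0 := by
    intro t
    rw [Measure.map_apply hp (measurableSet_singleton t)]
    refine hac ?_
    have := (EuclideanSpace.volume_preserving_symm_measurableEquiv_toLp (Fin d)).measure_preimage
      (s := {f : Fin d → ℝ | f 0 = t})
      (measurableSet_eq_fun (measurable_pi_apply 0) measurable_const).nullMeasurableSet
    rw [volume_pi, Measure.pi_hyperplane] at this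
    exact this
  obtain ⟨f, hf, hfmap⟩ := exists_map_eq_volume_unitInterval (μ.map p) hatom
  obtain ⟨g, hg, hgmap⟩ := ν.exists_measurable_map_eq
  refine ⟨fun x => g (f (p x)), hg.comp (hf.comp hp), ?_⟩
  rw [← hgmap, ← hfmap, Measure.map_map hf hp, Measure.map_map hg (hf.comp hp)]
  rfl

end TransportMap

/-! ### Properties of the chosen optimal map -/

section OptimalTransportMap

variable {d : ℕ} {μ ν : Measure (EuclideanSpace ℝ (Fin d))}
  {T : EuclideanSpace ℝ (Fin d) → EuclideanSpace ℝ (Fin d)}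

theorem memLp_map_id_iff (hT : Measurable T) : MemLp id 2 (μ.map T) ↔ MemLp T 2 μ :=
  memLp_map_measure_iff measurable_id.aestronglyMeasurable hT.aemeasurable

theorem IsConvexGradient.isOptimalTransportMap [IsProbabilityMeasure μ]
    (h : IsConvexGradient μ T) (hT : Measurable T) (hμ : MemLp id 2 μ) (hT2 : MemLp T 2 μ) :
    IsOptimalTransportMap μ (μ.map T) T :=
  ⟨hT, rfl, fun _ hS hST => h.lintegral_cost_le hT hS hST hμ hT2⟩

theorem exists_isOptimalTransportMap [IsProbabilityMeasure μ] [IsProbabilityMeasure ν]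
    (hac : μ ≪ volume) (hμ : MemLp id 2 μ) : ∃ T, IsOptimalTransportMap μ ν T := by
  by_cases hν : MemLp id 2 ν
  · obtain ⟨T, hT, rfl, hgrad⟩ := exists_isConvexGradient_map_eq hac hμ hν
    exact ⟨T, hgrad.isOptimalTransportMap hT hμ ((memLp_map_id_iff hT).1 hν)⟩
  -- In dimension 0 every second moment is finite, so this case needs `d > 0`. Every transport map
  -- then has infinite cost, and any one is optimal.
  · have hd : NeZero d := by
      refine ⟨?_⟩
      rintro rfl
      exact hν ((memLp_const (0 : EuclideanSpace ℝ (Fin 0))).congr_norm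
        measurable_id.aestronglyMeasurable (ae_of_all _ fun x => by
          rw [Subsingleton.elim (id x) 0]))
    obtain ⟨T, hT, rfl⟩ := exists_measurable_map_eq_of_absolutelyContinuous μ hac ν
    refine ⟨T, hT, rfl, fun S hS hST => ?_⟩
    have htop : ∫⁻ x, ‖S x - x‖ₑ ^ 2 ∂μ = ∞ := by
      by_contra h
      have h2 := (lintegral_enorm_sq_lt_top_iff_memLp
        (hS.sub measurable_id).aestronglyMeasurable).1 (lt_top_iff_ne_top.2 h)
      refine hν ?_
      rw [← hST, memLp_map_id_iff hS]
      simpa using h2.add hμ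
    rw [htop]
    exact le_top

theorem isOptimalTransportMap_otMap [IsProbabilityMeasure μ] [IsProbabilityMeasure ν]
    (hac : μ ≪ volume) (hμ : MemLp id 2 μ) : IsOptimalTransportMap μ ν (otMap μ ν) := by
  have h := exists_isOptimalTransportMap (ν := ν) hac hμ
  rw [otMap, dif_pos h]
  exact h.choose_spec

theorem IsConvexGradient.otMap_ae_eq [IsProbabilityMeasure μ] (hac : μ ≪ volume)
    (h : IsConvexGradient μ T) (hT : Measurable T) (hμ : MemLp id 2 μ) (hT2 : MemLp T 2 μ) :
    otMap μ (μ.map T) =ᵐ[μ] T := by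
  have := Measure.isProbabilityMeasure_map (μ := μ) hT.aemeasurable
  have hopt := isOptimalTransportMap_otMap (ν := μ.map T) hac hμ
  exact h.ae_eq_of_cost_le hac hT hopt.measurable hopt.map_eq hμ hT2 (hopt.cost_le T hT rfl)

theorem isConvexGradient_otMap [IsProbabilityMeasure μ] [IsProbabilityMeasure ν]
    (hac : μ ≪ volume) (hμ : MemLp id 2 μ) (hν : MemLp id 2 ν) :
    IsConvexGradient μ (otMap μ ν) := by
  obtain ⟨T, hT, rfl, hgrad⟩ := exists_isConvexGradient_map_eq hac hμ hν
  exact hgrad.congr (hgrad.otMap_ae_eq hac hT hμ ((memLp_map_id_iff hT).1 hν))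

end OptimalTransportMap

/-! ### Variance decomposition of the objective -/

section Barycenter

/-- Expanding about the mean `b`, the cross terms vanish because `∑ i, w i • (b - t i) = 0`. -/
theorem sum_mul_norm_sub_sq {ι E : Type*} [Fintype ι] [NormedAddCommGroup E]
    [InnerProductSpace ℝ E] {w : ι → ℝ} (hw : ∑ i, w i = 1) (t : ι → E) (x : E) :
    ∑ i, w i * ‖x - t i‖ ^ 2 =
      ‖x - ∑ i, w i • t i‖ ^ 2 + ∑ i, w i * ‖∑ j, w j • t j - t i‖ ^ 2 := by
  set b := ∑ i, w i • t i with hb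
  have h : ∀ i, w i * ‖x - t i‖ ^ 2 =
      w i * ‖x - b‖ ^ 2 + 2 * inner ℝ (x - b) (w i • b - w i • t i) + w i * ‖b - t i‖ ^ 2 := by
    intro i
    rw [← smul_sub, real_inner_smul_right, ← sub_add_sub_cancel x b (t i), norm_add_sq_real]
    ring
  rw [Finset.sum_congr rfl fun i _ => h i, Finset.sum_add_distrib, Finset.sum_add_distrib,
    ← Finset.sum_mul, hw, ← Finset.mul_sum, ← inner_sum, Finset.sum_sub_distrib, ← Finset.sum_smul,
    hw, ← hb]
  simp

theorem sum_mul_enorm_sub_sq {ι E : Type*} [Fintype ι] [NormedAddCommGroup E]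
    [InnerProductSpace ℝ E] {w : ι → ℝ} (hw0 : ∀ i, 0 ≤ w i) (hw : ∑ i, w i = 1) (t : ι → E)
    (x : E) :
    ∑ i, ENNReal.ofReal (w i) * ‖x - t i‖ₑ ^ 2 =
      ‖x - ∑ i, w i • t i‖ₑ ^ 2 +
        ∑ i, ENNReal.ofReal (w i) * ‖∑ j, w j • t j - t i‖ₑ ^ 2 := by
  have he : ∀ y : E, ‖y‖ₑ ^ 2 = ENNReal.ofReal (‖y‖ ^ 2) := fun y => by
    rw [ENNReal.ofReal_pow (norm_nonneg _), ofReal_norm]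
  simp only [he, ← ENNReal.ofReal_mul (hw0 _)]
  rw [← ENNReal.ofReal_sum_of_nonneg fun i _ => mul_nonneg (hw0 i) (by positivity),
    ← ENNReal.ofReal_sum_of_nonneg fun i _ => mul_nonneg (hw0 i) (by positivity),
    ← ENNReal.ofReal_add (by positivity)
      (Finset.sum_nonneg fun i _ => mul_nonneg (hw0 i) (by positivity)),
    sum_mul_norm_sub_sq hw]

theorem Measurable.enorm_sub_sq {α E : Type*} [MeasurableSpace α] [NormedAddCommGroup E]
    [MeasurableSpace E] [BorelSpace E] [SecondCountableTopology E] {f g : α → E}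
    (hf : Measurable f) (hg : Measurable g) : Measurable fun x => ‖f x - g x‖ₑ ^ 2 :=
  (hf.sub hg).enorm.pow_const 2

/-- Integrating the pointwise identity in `[0, ∞]` needs only measurability, so `ν` may have
infinite second moment. -/
theorem lbcmObjective_eq {d m : ℕ} {μ₀ : Measure (EuclideanSpace ℝ (Fin d))}
    {μ : Fin m → Measure (EuclideanSpace ℝ (Fin d))} {w : Fin m → ℝ}
    (hw0 : ∀ i, 0 ≤ w i) (hw : ∑ i, w i = 1) (hμ : ∀ i, Measurable (otMap μ₀ (μ i)))
    {ν : Measure (EuclideanSpace ℝ (Fin d))} (hν : Measurable (otMap μ₀ ν)) :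
    lbcmObjective μ₀ μ w ν =
      ∫⁻ x, ‖otMap μ₀ ν x - ∑ i, w i • otMap μ₀ (μ i) x‖ₑ ^ 2 ∂μ₀ +
        ∫⁻ x, ∑ i, ENNReal.ofReal (w i) *
          ‖∑ j, w j • otMap μ₀ (μ j) x - otMap μ₀ (μ i) x‖ₑ ^ 2 ∂μ₀ := by
  have hb : Measurable fun x => ∑ i, w i • otMap μ₀ (μ i) x :=
    Finset.measurable_fun_sum _ fun i _ => (hμ i).const_smul (w i)
  rw [← lintegral_add_left (hν.enorm_sub_sq hb)]
  simp only [lbcmObjective, lotDistSq]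
  rw [← lintegral_congr fun x => sum_mul_enorm_sub_sq hw0 hw (fun i => otMap μ₀ (μ i) x) _,
    lintegral_finsetSum _ fun i _ => (hν.enorm_sub_sq (hμ i)).const_mul _]
  refine Finset.sum_congr rfl fun i _ => ?_
  rw [lintegral_const_mul _ (hν.enorm_sub_sq (hμ i))]

end Barycenter

/-! ### The minimizer and its uniqueness -/

theorem mainTheorem3 {d m : ℕ}
    (μ₀ : Measure (EuclideanSpace ℝ (Fin d))) [IsProbabilityMeasure μ₀]
    (hμ₀_ac : μ₀ ≪ volume) (hμ₀_mom : MemLp id 2 μ₀)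
    (μ : Fin m → Measure (EuclideanSpace ℝ (Fin d))) [∀ i, IsProbabilityMeasure (μ i)]
    (hμ_mom : ∀ i, MemLp id 2 (μ i))
    (w : Fin m → ℝ) (hw : w ∈ stdSimplex ℝ (Fin m)) :
    MemLp id 2 (μ₀.map fun x => ∑ i, w i • otMap μ₀ (μ i) x) ∧
      lbcmArgmin μ₀ μ w = {μ₀.map fun x => ∑ i, w i • otMap μ₀ (μ i) x} := by
  obtain ⟨hw0, hw1⟩ := hw
  have hopt : ∀ ν : Measure (EuclideanSpace ℝ (Fin d)), IsProbabilityMeasure ν →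
      IsOptimalTransportMap μ₀ ν (otMap μ₀ ν) := fun ν _ =>
    isOptimalTransportMap_otMap hμ₀_ac hμ₀_mom
  have hm : ∀ i, Measurable (otMap μ₀ (μ i)) := fun i => (hopt (μ i) inferInstance).measurable
  have hL2 : ∀ i, MemLp (otMap μ₀ (μ i)) 2 μ₀ := fun i => by
    rw [← memLp_map_id_iff (hm i), (hopt (μ i) inferInstance).map_eq]
    exact hμ_mom i
  set b : EuclideanSpace ℝ (Fin d) → EuclideanSpace ℝ (Fin d) :=
    fun x => ∑ i, w i • otMap μ₀ (μ i) x
  have hb : Measurable b := Finset.measurable_fun_sum _ fun i _ => (hm i).const_smul (w i)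
  have hb2 : MemLp b 2 μ₀ := memLp_finsetSum _ fun i _ => (hL2 i).const_smul (w i)
  have hbgrad : IsConvexGradient μ₀ b :=
    IsConvexGradient.sum_smul (fun i => isConvexGradient_otMap hμ₀_ac hμ₀_mom (hμ_mom i)) hw0
  have hbprob : IsProbabilityMeasure (μ₀.map b) := Measure.isProbabilityMeasure_map hb.aemeasurable
  have hae : otMap μ₀ (μ₀.map b) =ᵐ[μ₀] b := hbgrad.otMap_ae_eq hμ₀_ac hb hμ₀_mom hb2
  let K : ℝ≥0∞ := ∫⁻ x, ∑ i, ENNReal.ofReal (w i) * ‖b x - otMap μ₀ (μ i) x‖ₑ ^ 2 ∂μ₀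
  -- Finiteness of `K` is what allows it to be cancelled in the uniqueness argument.
  have hK : K ≠ ∞ := by
    simp only [K]
    rw [lintegral_finsetSum _ fun i _ => (hb.enorm_sub_sq (hm i)).const_mul _]
    refine ENNReal.sum_ne_top.2 fun i _ => ?_
    rw [lintegral_const_mul _ (hb.enorm_sub_sq (hm i))]
    exact ENNReal.mul_ne_top ENNReal.ofReal_ne_top ((lintegral_enorm_sq_lt_top_iff_memLp
      (hb.sub (hm i)).aestronglyMeasurable).2 (hb2.sub (hL2 i))).ne
  have hobj : ∀ ν : Measure (EuclideanSpace ℝ (Fin d)), IsProbabilityMeasure ν →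
      lbcmObjective μ₀ μ w ν = ∫⁻ x, ‖otMap μ₀ ν x - b x‖ₑ ^ 2 ∂μ₀ + K := fun ν hν =>
    lbcmObjective_eq hw0 hw1 hm (hopt ν hν).measurable
  have hobjb : lbcmObjective μ₀ μ w (μ₀.map b) = K := by
    rw [hobj _ hbprob, lintegral_congr_ae (g := fun _ => 0), lintegral_zero, zero_add]
    filter_upwards [hae] with x hx
    simp [hx]
  refine ⟨(memLp_map_id_iff hb).2 hb2, Set.eq_singleton_iff_unique_mem.2
    ⟨⟨hbprob, fun η hη => ?_⟩, fun ν ⟨hν, hmin⟩ => ?_⟩⟩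
  · rw [hobjb, hobj η hη]
    exact le_add_self
  · have hle := hmin _ hbprob
    rw [hobjb, hobj ν hν] at hle
    have h0 : ∫⁻ x, ‖otMap μ₀ ν x - b x‖ₑ ^ 2 ∂μ₀ = 0 := by
      have : ∫⁻ x, ‖otMap μ₀ ν x - b x‖ₑ ^ 2 ∂μ₀ + K ≤ 0 + K := by rwa [zero_add]
      exact le_zero_iff.1 ((ENNReal.add_le_add_iff_right hK).1 this)
    rw [lintegral_eq_zero_iff ((hopt ν hν).measurable.enorm_sub_sq hb)] at h0
    rw [← (hopt ν hν).map_eq]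
    refine Measure.map_congr ?_
    filter_upwards [h0] with x hx
    simpa [sub_eq_zero] using hx
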